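/- Let the players be $P_1,\dots,P_m$. A distribution type for $m$ players is a vector $\bar s=(s_P)_P$ of natural numbers indexed by the players; put $|\bar s|=\sum_P s_P$. A deal of type $\bar s$ is a partition $H=(H_P)_P$ of the deck $\{1,\dots,|\bar s|\}$ with $\#H_P=s_P$ for every player $P$. An action is either a set of deals (an announcement) or the symbol $\mathrm{end}$. A run is a finite sequence of actions; it is terminal if its last action is $\mathrm{end}$, and proper if $\mathrm{end}$ does not occur except possibly as its last action. A protocol $\pi$ for $\bar s$ assigns to every deal $H$ and every non-terminal proper run $\rho$ a non-empty set $\pi(H,\rho)$ of actions such that $H\in\alpha$ for each announcement $\alpha\in\pi(H,\rho)$, and such that $\pi(H,\rho)=\pi(H',\rho)$ whenever $H_{P_i}=H'_{P_i}$, where $P_i$ is the player whose turn it is, i.e. $1\le i\le m$ and $i\equiv|\rho|+1 \pmod m$. An execution of $\pi$ is a pair of a deal $H$ and a run $\alpha_1,\dots,\alpha_n$ with $\alpha_{i+1}\in\pi(H,(\alpha_1,\dots,\alpha_i))$ for all $0\le i<n$ (an infinite execution is defined in the same way with an infinite sequence of actions), and $\pi$ is terminating if it has no infinite execution. A $k$-diffusion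 is a set $\Delta$ of exactly $k$ deals of type $\bar s$ such that $H_P\ne H'_P$ for every player $P$ and all distinct $H,H'\in\Delta$, and such that for every card $c$ there are $H,H'\in\Delta$ and a player $P$ with $c\in H_P$ and $c\notin H'_P$. The distribution type $\bar s$ is $k$-solvable if there is a terminating protocol $\pi$ for $\bar s$ such that, for every execution $(H,\rho)$ of $\pi$ with $\rho$ terminal, the set of all deals $H'$ for which $(H',\rho)$ is an execution of $\pi$ is a $k$-diffusion. Theorem (Restricted solvability). Let $m>2$ and $k>2m$ be integers. There exists $N$ such that every distribution type $\bar s$ for $m$ players with $|\bar s|>N$ and \[k^2\le k\,s_P\le (k-1)\,|\bar s|\qquad\text{for every player }P\] is $k$-solvable. -/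

import Mathlib

/-! Deals of cards, announcement protocols, and `k`-solvability of the problem of safely and
informatively aggregating distributed information. The players are the elements of `Fin m`. -/

namespace SADI

/-- The total number of cards `|s|` of a distribution type `s`. -/
def size {m : ℕ} (s : Fin m → ℕ) : ℕ := ∑ P, s P

/-- A deal of type `s` over the deck `C`: a partition of `C` into hands (possibly empty ones),
the hand of `P` having `s P` cards. -/
@[ext]
structure Deal {m : ℕ} (s : Fin m → ℕ) (C : Type) where
  /-- the hand of each player -/
  hand : Fin m → Finset C
  disjoint : ∀ P Q, P ≠ Q → Disjoint (hand P) (hand Q)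
  cover : ∀ c, ∃ P, c ∈ hand P
  card_hand : ∀ P, (hand P).card = s P

/-- An action: the announcement of a set of deals, or the action that ends the exchange. -/
inductive Action {m : ℕ} (s : Fin m → ℕ) (C : Type) where
  | announce (S : Set (Deal s C)) : Action s C
  | finish : Action s C

/-- A finite run: a list of actions, in chronological order. -/
abbrev Run {m : ℕ} (s : Fin m → ℕ) (C : Type) := List (Action s C)

/-- The run ends with the action `finish`. -/
def Run.IsTerminal {m : ℕ} {s : Fin m → ℕ} {C : Type} (ρ : Run s C) : Prop :=
  ρ.getLast? = some Action.finish

/-- The run is proper (`finish` does not occur except possibly as the last action) and not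
terminal, that is, `finish` does not occur in it at all. -/
def Run.IsOngoing {m : ℕ} {s : Fin m → ℕ} {C : Type} (ρ : Run s C) : Prop :=
  Action.finish ∉ ρ

/-- A protocol assigns to every deal and every non-terminal proper run a non-empty set of actions.
Announcements are truthful, and the set depends only on the hand of the player whose turn it is
and on the run. The players take turns `0, 1, …, m - 1, 0, 1, …`. The values of `next` on other
runs play no role. -/
structure Protocol {m : ℕ} (s : Fin m → ℕ) (C : Type) where
  /-- the actions allowed at a given deal after a given run -/
  next : Deal s C → Run s C → Set (Action s C)
  nonempty : ∀ H ρ, Run.IsOngoing ρ → (next H ρ).Nonempty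
  truthful : ∀ H ρ, Run.IsOngoing ρ → ∀ S, Action.announce S ∈ next H ρ → H ∈ S
  local_view : ∀ H H' ρ, Run.IsOngoing ρ → ∀ P : Fin m, (P : ℕ) = ρ.length % m →
    H.hand P = H'.hand P → next H ρ = next H' ρ

namespace Protocol

variable {m : ℕ} {s : Fin m → ℕ} {C : Type}

/-- `(H, ρ)` is an execution of `π`: every action of `ρ` is allowed by `π` at `H` after the
actions that precede it (which thus do not contain `finish`). -/
def IsExecution (π : Protocol s C) (H : Deal s C) (ρ : Run s C) : Prop :=
  ∀ (i : ℕ) (hi : i < ρ.length),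
    Run.IsOngoing (ρ.take i) ∧ ρ[i] ∈ π.next H (ρ.take i)

/-- `π` has no infinite executions. -/
def IsTerminating (π : Protocol s C) : Prop :=
  ¬ ∃ (H : Deal s C) (α : ℕ → Action s C), ∀ n : ℕ, π.IsExecution H ((List.range n).map α)

/-- The eavesdropper's ignorance set: the deals that are compatible with the run. -/
def ignorance (π : Protocol s C) (ρ : Run s C) : Set (Deal s C) :=
  {H | π.IsExecution H ρ}

end Protocol

/-- A `k`-diffusion: a set of exactly `k` deals such that each player's hand tells its elements
apart, and no card is held by the same player in all of them. -/
structure IsDiffusion {m : ℕ} {s : Fin m → ℕ} {C : Type} (k : ℕ) (Δ : Set (Deal s C)) :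
    Prop where
  distinguishes : ∀ H ∈ Δ, ∀ H' ∈ Δ, H ≠ H' → ∀ P, H.hand P ≠ H'.hand P
  moves : ∀ c : C, ∃ H ∈ Δ, ∃ H' ∈ Δ, ∃ P, c ∈ H.hand P ∧ c ∉ H'.hand P
  encard_eq : Δ.encard = k

/-- A `k`-solution: a terminating protocol such that, at the end of every terminal execution, the
eavesdropper's ignorance set is a `k`-diffusion. -/
structure Protocol.IsSolution {m : ℕ} {s : Fin m → ℕ} {C : Type} (k : ℕ)
    (π : Protocol s C) : Prop where
  terminating : π.IsTerminating
  diffusion : ∀ (H : Deal s C) (ρ : Run s C), π.IsExecution H ρ → Run.IsTerminal ρ →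
    IsDiffusion k (π.ignorance ρ)

/-- The distribution type `s` is `k`-solvable: there is a `k`-solution over the standard deck
with `|s|` cards. -/
def Solvable {m : ℕ} (k : ℕ) (s : Fin m → ℕ) : Prop :=
  ∃ π : Protocol s (Fin (size s)), π.IsSolution k

end SADI

/-! The players shrink the set of deals compatible with the announcements until it is a
`k`-diffusion. If every deal in an announced set permits that announcement, the eavesdropper learns
only that it is true; a strategy in the sense of `Reducible` therefore yields a solution
(`Reducible.exists_isSolution`).

The deck is publicly cut into groups of 2 to `k` cards, in each of which one player holds all cards
but one and another player holds the odd card. Which card is the odd one remains open, independently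
in each group. In order of rank, the players then announce `k` alternatives for their own groups,
aligned with the `k` columns fixed by their predecessors, so that exactly `k` deals survive
(`Grouping.reducible_deals`). A player can align them because she holds the odd card in `k` groups
shared with players of lower rank, one to identify each column.

Cutting the deck is a game (`Winning`): a player offers some of her cards and one foreign card,
whose owner she cannot predict. While nobody has half of the remaining cards, groups of `k` cards
are formed by the player with the smallest initial hand among those who still have `2k` cards, the
largest initial hand excepted (`winning_of_isReached`). Once someone has half, she forms all
remaining groups (`winning_of_majority`). In the final ranking she is lowest and the others follow
by decreasing initial hand. -/

namespace SADI

/-! ### From strategies of announcements to protocols. -/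

variable {m : ℕ} {s : Fin m → ℕ} {C : Type}

/-- A set of deals from which the players can always reach a `k`-diffusion by announcements: it is
one already, or some player can announce, whatever her hand `h`, a set `F h` of hands containing
`h`, such that this is still true afterwards. -/
inductive Reducible (k : ℕ) : Set (Deal s C) → Prop
  | diffusion (Ω : Set (Deal s C)) : IsDiffusion k Ω → Reducible k Ω
  | step (Ω : Set (Deal s C)) (P : Fin m) (F : Finset C → Set (Finset C)) :
      (∀ h, h ∈ F h) →
      (∀ H ∈ Ω, Reducible k (Ω ∩ {H' | H'.hand P ∈ F (H.hand P)})) → Reducible k Ω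

/-- The set `S` may be found with the whole deal in view: what is required of it involves the deal
only through the hand of `P`, so it can be chosen as a function of that hand. -/
theorem Reducible.of_forall_exists {k : ℕ} {Ω : Set (Deal s C)} (P : Fin m)
    (h : ∀ H ∈ Ω, ∃ S : Set (Finset C), H.hand P ∈ S ∧
      Reducible k (Ω ∩ {H' | H'.hand P ∈ S})) : Reducible k Ω := by
  classical
  let F : Finset C → Set (Finset C) := fun x =>
    if hx : ∃ S : Set (Finset C), x ∈ S ∧ Reducible k (Ω ∩ {H' | H'.hand P ∈ S})
    then hx.choose else Set.univ
  refine .step Ω P F (fun x => ?_) (fun H hH => ?_)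
  · by_cases hx : ∃ S : Set (Finset C), x ∈ S ∧ Reducible k (Ω ∩ {H' | H'.hand P ∈ S})
    · simp only [F, dif_pos hx]; exact hx.choose_spec.1
    · simp only [F, dif_neg hx]; trivial
  · simp only [F, dif_pos (h H hH)]; exact (h H hH).choose_spec.2

/-- The announcements of `P` according to `F` preserve reducibility and are always informative. -/
def IsStrictStep (k : ℕ) (Ω : Set (Deal s C)) (P : Fin m) (F : Finset C → Set (Finset C)) : Prop :=
  (∀ h, h ∈ F h) ∧ ∀ H ∈ Ω, Reducible k (Ω ∩ {H' | H'.hand P ∈ F (H.hand P)}) ∧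
    Ω ∩ {H' | H'.hand P ∈ F (H.hand P)} ≠ Ω

/-- A step that is uninformative at some deal leaves `Ω` unchanged, so it can be skipped by
induction. -/
theorem Reducible.exists_strictStep {k : ℕ} {Ω : Set (Deal s C)} (h : Reducible k Ω) :
    IsDiffusion k Ω ∨ ∃ q : Fin m × (Finset C → Set (Finset C)), IsStrictStep k Ω q.1 q.2 := by
  induction h with
  | diffusion Ω h => exact .inl h
  | step Ω P F hF h ih =>
    by_cases hne : ∀ H ∈ Ω, Ω ∩ {H' | H'.hand P ∈ F (H.hand P)} ≠ Ω
    · exact .inr ⟨(P, F), hF, fun H hH => ⟨h H hH, hne H hH⟩⟩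
    · push Not at hne
      obtain ⟨H, hH, he⟩ := hne
      have := ih H hH
      rwa [he] at this

/-- The deals that make all announcements of a run true. -/
def Run.truth (ρ : Run s C) : Set (Deal s C) := {H | ∀ S, Action.announce S ∈ ρ → H ∈ S}

theorem Run.truth_append (ρ : Run s C) (S : Set (Deal s C)) :
    Run.truth (ρ ++ [Action.announce S]) = Run.truth ρ ∩ S := by
  ext H
  simp only [Run.truth, Set.mem_ofPred_eq, List.mem_append, List.mem_singleton, Set.mem_inter_iff,
    Action.announce.injEq]
  constructor
  · exact fun h => ⟨fun T hT => h T (.inl hT), h S (.inr rfl)⟩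
  · rintro ⟨h1, h2⟩ T (hT | rfl)
    · exact h1 T hT
    · exact h2

/-- The announcements with which a player holding `h` may follow `F` in the state `Ω`. -/
def stepActions (Ω : Set (Deal s C)) (P : Fin m) (F : Finset C → Set (Finset C)) (h : Finset C) :
    Set (Action s C) :=
  {a | ∃ H ∈ Ω, h ∈ F (H.hand P) ∧ a = Action.announce {H' | H'.hand P ∈ F (H.hand P)}}

open Classical in
/-- The actions at the deal `H` after the run `ρ` in the protocol that follows strict steps. -/
noncomputable def followActions (k : ℕ) (H : Deal s C) (ρ : Run s C) : Set (Action s C) :=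
  if IsDiffusion k (Run.truth ρ) then {Action.finish}
  else if h : ∃ q : Fin m × (Finset C → Set (Finset C)), IsStrictStep k (Run.truth ρ) q.1 q.2 then
    if (h.choose.1 : ℕ) = ρ.length % m ∧
        (stepActions (Run.truth ρ) h.choose.1 h.choose.2 (H.hand h.choose.1)).Nonempty
    then stepActions (Run.truth ρ) h.choose.1 h.choose.2 (H.hand h.choose.1)
    else {Action.announce Set.univ}
  else {Action.announce Set.univ}

/-- The protocol that follows strict steps until the state is a diffusion. -/
noncomputable def followProtocol (k : ℕ) (s : Fin m → ℕ) (C : Type) : Protocol s C where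
  next := followActions k
  nonempty H ρ _ := by
    unfold followActions
    split_ifs with h1 h2 h3
    · exact Set.singleton_nonempty _
    · exact h3.2
    · exact Set.singleton_nonempty _
    · exact Set.singleton_nonempty _
  truthful H ρ _ S hS := by
    unfold followActions at hS
    split_ifs at hS with h1 h2 h3
    · simp at hS
    · obtain ⟨H', -, h, he⟩ := hS
      rw [Action.announce.injEq] at he
      rw [he]; exact h
    · simp only [Set.mem_singleton_iff, Action.announce.injEq] at hS
      rw [hS]; trivial
    · simp only [Set.mem_singleton_iff, Action.announce.injEq] at hS
      rw [hS]; trivial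
  local_view H H' ρ _ P hP hh := by
    unfold followActions
    by_cases h1 : IsDiffusion k (Run.truth ρ)
    · simp only [if_pos h1]
    by_cases h2 : ∃ q : Fin m × (Finset C → Set (Finset C)), IsStrictStep k (Run.truth ρ) q.1 q.2
    · simp only [if_neg h1, dif_pos h2]
      by_cases hq : (h2.choose.1 : ℕ) = ρ.length % m
      · have e : h2.choose.1 = P := Fin.ext (hq.trans hP.symm)
        have e' : H.hand h2.choose.1 = H'.hand h2.choose.1 := by rw [e, hh]
        rw [e']
      · simp only [hq, false_and, if_false]
    · simp only [if_neg h1, dif_neg h2]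

theorem Protocol.isExecution_append (π : Protocol s C) (H : Deal s C) (ρ : Run s C)
    (a : Action s C) :
    π.IsExecution H (ρ ++ [a]) ↔
      π.IsExecution H ρ ∧ Run.IsOngoing ρ ∧ a ∈ π.next H ρ := by
  unfold Protocol.IsExecution
  constructor
  · intro h
    refine ⟨fun i hi => ?_, ?_⟩
    · have := h i (by simp; omega)
      rwa [List.take_append_of_le_length hi.le, List.getElem_append_left hi] at this
    · simpa using h ρ.length (by simp)
  · rintro ⟨h1, h2⟩ i hi
    rcases Nat.lt_or_ge i ρ.length with hl | hl
    · rw [List.take_append_of_le_length hl.le, List.getElem_append_left hl]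
      exact h1 i hl
    · obtain rfl : i = ρ.length := by simp at hi; omega
      simpa using h2

theorem Protocol.IsExecution.mem_truth {π : Protocol s C} {H : Deal s C} {ρ : Run s C}
    (h : π.IsExecution H ρ) : H ∈ Run.truth ρ := by
  intro S hS
  obtain ⟨i, hi, he⟩ := List.getElem_of_mem hS
  have := h i hi
  rw [he] at this
  exact π.truthful H _ this.1 S this.2

theorem followProtocol_next {k : ℕ} {Ω : Set (Deal s C)} (hr : Reducible k Ω)
    (hd : ¬ IsDiffusion k Ω) :
    ∃ P F, IsStrictStep k Ω P F ∧ ∀ ρ : Run s C, Run.truth ρ = Ω → ∀ H ∈ Ω,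
      (followProtocol k s C).next H ρ = if (P : ℕ) = ρ.length % m
        then stepActions Ω P F (H.hand P) else {Action.announce Set.univ} := by
  have h2 := hr.exists_strictStep.resolve_left hd
  refine ⟨h2.choose.1, h2.choose.2, h2.choose_spec, fun ρ hρ H hH => ?_⟩
  subst hρ
  have hne : (stepActions (Run.truth ρ) h2.choose.1 h2.choose.2 (H.hand h2.choose.1)).Nonempty :=
    ⟨_, H, hH, h2.choose_spec.1 _, rfl⟩
  simp only [followProtocol, followActions, if_neg hd, dif_pos h2, hne, and_true]

/-- An announcement from `stepActions` is open to every deal in the state that makes it true, and a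
trivial one to all. Hence a run excludes only the deals that falsify one of its announcements. -/
theorem followProtocol_invariant {k : ℕ} (hr : Reducible k (Set.univ : Set (Deal s C)))
    (ρ : Run s C) : Run.IsOngoing ρ → ∀ H₀, (followProtocol k s C).IsExecution H₀ ρ →
      Reducible k (Run.truth ρ) ∧ ∀ H ∈ Run.truth ρ, (followProtocol k s C).IsExecution H ρ := by
  induction ρ using List.reverseRecOn with
  | nil =>
    intro _ _ _
    have : Run.truth ([] : Run s C) = Set.univ := by ext; simp [Run.truth]
    rw [this]
    exact ⟨hr, fun H _ i hi => by simp at hi⟩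
  | append_singleton ρ a ih =>
    intro ho H₀ h
    rw [Protocol.isExecution_append] at h
    obtain ⟨h0, ho', ha⟩ := h
    obtain ⟨hr', hx⟩ := ih ho' H₀ h0
    by_cases hd : IsDiffusion k (Run.truth ρ)
    · have : a = Action.finish := by
        simpa [followProtocol, followActions, hd] using ha
      subst this
      simp [Run.IsOngoing] at ho
    obtain ⟨P, F, hs, hn⟩ := followProtocol_next hr' hd
    replace hn := hn ρ rfl
    rw [hn H₀ h0.mem_truth] at ha
    by_cases hP : (P : ℕ) = ρ.length % m
    · rw [if_pos hP] at ha
      obtain ⟨H₁, hH₁, hm, rfl⟩ := ha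
      rw [Run.truth_append]
      refine ⟨(hs.2 H₁ hH₁).1, fun H hH => ?_⟩
      rw [Protocol.isExecution_append, hn H hH.1, if_pos hP]
      exact ⟨hx H hH.1, ho', H₁, hH₁, hH.2, rfl⟩
    · rw [if_neg hP, Set.mem_singleton_iff] at ha
      subst ha
      rw [Run.truth_append, Set.inter_univ]
      refine ⟨hr', fun H hH => ?_⟩
      rw [Protocol.isExecution_append, hn H hH, if_neg hP]
      exact ⟨hx H hH, ho', rfl⟩

instance [Finite C] : Finite (Deal s C) :=
  Finite.of_injective (fun H : Deal s C => H.hand) fun _ _ h => Deal.ext h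

/-- The finite set of deals true to the run strictly shrinks whenever the acting player has her
turn; the others only wait for it with trivial announcements. -/
theorem followProtocol_isTerminating [Finite C] (hm : 0 < m) {k : ℕ}
    (hr : Reducible k (Set.univ : Set (Deal s C))) : (followProtocol k s C).IsTerminating := by
  rintro ⟨H, α, h⟩
  set ρ : ℕ → Run s C := fun n => (List.range n).map α with hρ
  have succ : ∀ n, ρ (n + 1) = ρ n ++ [α n] := fun n => by simp [hρ, List.range_succ]
  have len : ∀ n, (ρ n).length = n := fun n => by simp [hρ]
  have key : ∀ n, Run.IsOngoing (ρ n) ∧ α n ∈ (followProtocol k s C).next H (ρ n) := fun n => by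
    have := h (n + 1)
    rw [← hρ] at *
    change Protocol.IsExecution _ _ (ρ (n + 1)) at this
    rw [succ, Protocol.isExecution_append] at this
    exact this.2
  have red : ∀ n, Reducible k (Run.truth (ρ n)) := fun n =>
    (followProtocol_invariant hr (ρ n) (key n).1 H (h n)).1
  have nd : ∀ n, ¬ IsDiffusion k (Run.truth (ρ n)) := fun n hd => by
    have h1 := (key n).2
    simp only [followProtocol, followActions, if_pos hd, Set.mem_singleton_iff] at h1
    have h2 := (key (n + 1)).1
    rw [succ, h1] at h2
    simp [Run.IsOngoing] at h2
  have mem : ∀ n, H ∈ Run.truth (ρ n) := fun n => (h n).mem_truth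
  have main : ∀ c n : ℕ, (Run.truth (ρ n)).ncard = c → False := by
    intro c
    induction c using Nat.strong_induction_on with
    | _ c ih =>
      intro n₀ hc
      obtain ⟨P, F, hs, hn⟩ := followProtocol_next (red n₀) (nd n₀)
      have turn : ∀ n, Run.truth (ρ n) = Run.truth (ρ n₀) → (P : ℕ) = n % m → False := by
        intro n hΩ hP
        have h1 := (key n).2
        rw [hn _ hΩ H (mem n₀), len, if_pos hP] at h1
        obtain ⟨H₁, hH₁, -, he⟩ := h1
        refine ih (Run.truth (ρ (n + 1))).ncard ?_ (n + 1) rfl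
        rw [succ, he, Run.truth_append, ← hc, hΩ]
        exact Set.ncard_lt_ncard
          (Set.inter_subset_left.ssubset_of_ne (hs.2 H₁ hH₁).2) (Set.toFinite _)
      have wait : ∀ d n, Run.truth (ρ n) = Run.truth (ρ n₀) → (P : ℕ) = (n + d) % m → False := by
        intro d
        induction d with
        | zero => exact turn
        | succ d ihd =>
          intro n hΩ hP
          by_cases hP' : (P : ℕ) = n % m
          · exact turn n hΩ hP'
          · have h1 := (key n).2
            rw [hn _ hΩ H (mem n₀), len, if_neg hP', Set.mem_singleton_iff] at h1
            refine ihd (n + 1) ?_ (by rw [hP]; congr 1; ring)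
            rw [succ, h1, Run.truth_append, Set.inter_univ, hΩ]
      -- Any delay `d` with `n₀ + d` congruent to `P` modulo `m` will do.
      refine wait (P + m * n₀ - n₀) n₀ rfl ?_
      have : n₀ ≤ m * n₀ := Nat.le_mul_of_pos_left _ hm
      rw [show n₀ + (P + m * n₀ - n₀) = P + m * n₀ by omega, Nat.add_mul_mod_self_left,
        Nat.mod_eq_of_lt P.isLt]
  exact main _ 0 rfl

theorem Reducible.exists_isSolution [Finite C] (hm : 0 < m) {k : ℕ}
    (hr : Reducible k (Set.univ : Set (Deal s C))) : ∃ π : Protocol s C, π.IsSolution k := by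
  refine ⟨followProtocol k s C, followProtocol_isTerminating hm hr, fun H ρ h ht => ?_⟩
  obtain ⟨ρ, rfl⟩ : ∃ ρ', ρ = ρ' ++ [Action.finish] :=
    ⟨_, (List.dropLast_append_getLast? _ ht).symm⟩
  rw [Protocol.isExecution_append] at h
  obtain ⟨h0, ho, hf⟩ := h
  obtain ⟨hr', hx⟩ := followProtocol_invariant hr ρ ho H h0
  have hd : IsDiffusion k (Run.truth ρ) := by
    by_contra hd
    obtain ⟨P, F, hs, hn⟩ := followProtocol_next hr' hd
    rw [hn ρ rfl H h0.mem_truth] at hf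
    split_ifs at hf
    · obtain ⟨_, _, _, he⟩ := hf
      cases he
    · cases hf
  have : (followProtocol k s C).ignorance (ρ ++ [Action.finish]) = Run.truth ρ := by
    ext H'
    simp only [Protocol.ignorance, Set.mem_ofPred_eq, Protocol.isExecution_append]
    refine ⟨fun h => h.1.mem_truth, fun h => ⟨hx H' h, ho, ?_⟩⟩
    simp [followProtocol, followActions, hd]
  rwa [this]

/-! ### Labels and onto maps. -/

/-- A map onto `G` that takes a prescribed value at `t₀`, and takes its value at `a` only once. -/
theorem exists_onto_isolating {α : Type*} {k : ℕ} (G : Finset α) (h2 : 2 ≤ G.card)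
    (hk : G.card ≤ k) (a t₀ : Fin k) {x₀ : α} (hx₀ : x₀ ∈ G) :
    ∃ f : Fin k → α, (∀ t, f t ∈ G) ∧ (∀ x ∈ G, ∃ t, f t = x) ∧ f t₀ = x₀ ∧
      ∀ t, t ≠ a → f t ≠ f a := by
  classical
  obtain ⟨y, hy⟩ : G.Nonempty := Finset.card_pos.1 (by omega)
  have hc : Fintype.card (G.erase y : Finset α) ≤ Fintype.card {t : Fin k // t ≠ a} := by
    rw [Fintype.card_coe, Finset.card_erase_of_mem hy, Fintype.card_subtype_compl]
    simp; omega
  have hne : Nonempty (G.erase y : Finset α) := by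
    have : 0 < (G.erase y).card := by rw [Finset.card_erase_of_mem hy]; omega
    obtain ⟨z, hz⟩ := Finset.card_pos.1 this
    exact ⟨⟨z, hz⟩⟩
  obtain ⟨e⟩ := Function.Embedding.nonempty_of_card_le hc
  -- The index `a` alone is sent to `y`, and the other indices cover the rest of `G`.
  let q : Fin k → α := fun t => if h : t = a then y else (Function.invFun e ⟨t, h⟩ : G.erase y)
  have hq : ∀ t, q t ∈ G := fun t => by
    by_cases h : t = a
    · simpa [q, h] using hy
    · simp only [q, dif_neg h]
      exact Finset.mem_of_mem_erase (Function.invFun e ⟨t, h⟩).2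
  have hs : ∀ x ∈ G, ∃ t, q t = x := fun x hx => by
    by_cases h : x = y
    · exact ⟨a, by simp [q, h]⟩
    · obtain ⟨⟨t, ht⟩, h'⟩ := Function.invFun_surjective e.injective ⟨x, Finset.mem_erase.2 ⟨h, hx⟩⟩
      exact ⟨t, by simp only [q, dif_neg ht, h']⟩
  have hi : ∀ t, t ≠ a → q t ≠ q a := fun t h => by
    simp only [q, dif_neg h, dif_pos]
    exact Finset.ne_of_mem_erase (Function.invFun e ⟨t, h⟩).2
  -- Permuting the values inside `G` corrects the value at `t₀` and preserves the other properties.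
  let π := Equiv.swap (q t₀) x₀
  have hπ : ∀ x ∈ G, π x ∈ G := fun x hx => by
    simp only [π, Equiv.swap_apply_def]
    split_ifs
    exacts [hx₀, hq _, hx]
  refine ⟨fun t => π (q t), fun t => hπ _ (hq t), fun x hx => ?_, by simp [π], fun t h h' =>
    hi t h (π.injective h')⟩
  obtain ⟨t, ht⟩ := hs (π x) (hπ x hx)
  exact ⟨t, by simp [ht, π]⟩

/-- For each `p`, the indices in `K p` (at least `k` of them, and these sets are disjoint) can be
labelled with all elements of `Fin k`. -/
theorem exists_labelling {ι β : Type*} [Fintype ι] {k : ℕ} (hk : 0 < k) (key : ι → β)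
    (K : β → Finset ι) (hK : ∀ p, ∀ l ∈ K p, key l = p) :
    ∃ a : ι → Fin k, ∀ p, k ≤ (K p).card → ∀ t, ∃ l ∈ K p, a l = t := by
  classical
  have : Nonempty (Fin k) := ⟨⟨0, hk⟩⟩
  have h : ∀ p, ∃ b : ι → Fin k, k ≤ (K p).card → ∀ t, ∃ l ∈ K p, b l = t := fun p => by
    by_cases hp : k ≤ (K p).card
    · obtain ⟨e⟩ := Function.Embedding.nonempty_of_card_le
        (show Fintype.card (Fin k) ≤ Fintype.card (K p) by simpa using hp)
      refine ⟨fun l => if h : l ∈ K p then Function.invFun e ⟨l, h⟩ else ⟨0, hk⟩, fun _ t => ?_⟩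
      obtain ⟨⟨l, hl⟩, h⟩ := Function.invFun_surjective e.injective t
      exact ⟨l, hl, by simp only [dif_pos hl, h]⟩
    · exact ⟨fun _ => ⟨0, hk⟩, fun h => absurd h hp⟩
  choose b hb using h
  refine ⟨fun l => b (key l) l, fun p hp t => ?_⟩
  obtain ⟨l, hl, h⟩ := hb p hp t
  exact ⟨l, hl, by simp only [hK p l hl, h]⟩

theorem Deal.eq_of_mem (H : Deal s C) {P Q : Fin m} {c : C} (hP : c ∈ H.hand P)
    (hQ : c ∈ H.hand Q) : P = Q := by
  by_contra h
  exact Finset.disjoint_left.1 (H.disjoint P Q h) hP hQ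

/-! ### Groupings and the deals they leave open. -/

/-- A partition of the deck into groups of size `2, …, k`, with two players designated for each. -/
structure Grouping (m : ℕ) (C : Type) (k : ℕ) (ι : Type) where
  cards : ι → Finset C
  main : ι → Fin m
  single : ι → Fin m
  main_ne : ∀ l, main l ≠ single l
  two_le : ∀ l, 2 ≤ (cards l).card
  le_k : ∀ l, (cards l).card ≤ k
  unique : ∀ l l' c, c ∈ cards l → c ∈ cards l' → l = l'
  cover : ∀ c, ∃ l, c ∈ cards l

namespace Grouping
variable {k : ℕ} {ι : Type} (Γ : Grouping m C k ι)

/-- In each group `l`, the player `main l` holds all cards but one, and `single l` holds one. -/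
def deals (s : Fin m → ℕ) : Set (Deal s C) :=
  {H | ∀ l, ∃ x ∈ Γ.cards l, x ∈ H.hand (Γ.single l) ∧
    ∀ y ∈ Γ.cards l, y ≠ x → y ∈ H.hand (Γ.main l)}

variable {Γ}

theorem mem_main_iff {H : Deal s C} (hH : H ∈ Γ.deals s) {l : ι} {x : C} (hx : x ∈ Γ.cards l) :
    x ∈ H.hand (Γ.main l) ↔ x ∉ H.hand (Γ.single l) := by
  obtain ⟨z, hz, hzs, h⟩ := hH l
  constructor
  · exact fun h1 h2 => Γ.main_ne l (H.eq_of_mem h1 h2)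
  · intro h1
    refine h x hx ?_
    rintro rfl
    exact h1 hzs

theorem eq_of_mem_single {H : Deal s C} (hH : H ∈ Γ.deals s) {l : ι} {x y : C}
    (hx : x ∈ Γ.cards l) (hy : y ∈ Γ.cards l) (hx' : x ∈ H.hand (Γ.single l))
    (hy' : y ∈ H.hand (Γ.single l)) : x = y := by
  obtain ⟨z, hz, hzs, h⟩ := hH l
  have : ∀ x ∈ Γ.cards l, x ∈ H.hand (Γ.single l) → x = z := fun x hx hx' => by
    by_contra hne
    exact (mem_main_iff hH hx).1 (h x hx hne) hx'
  rw [this x hx hx', this y hy hy']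

/-- The card held by `single l` determines the group, hence these cards determine the deal. -/
theorem deal_ext {H H' : Deal s C} (hH : H ∈ Γ.deals s) (hH' : H' ∈ Γ.deals s)
    (h : ∀ l, ∃ x ∈ Γ.cards l, x ∈ H.hand (Γ.single l) ∧ x ∈ H'.hand (Γ.single l)) : H = H' := by
  have key : ∀ P c, c ∈ H.hand P → c ∈ H'.hand P := by
    intro P c hc
    obtain ⟨l, hl⟩ := Γ.cover c
    obtain ⟨x, hx, h1, h2⟩ := h l
    by_cases hcx : c = x
    · subst hcx
      rwa [H.eq_of_mem hc h1]
    · have h3 : c ∉ H.hand (Γ.single l) := fun h3 => hcx (eq_of_mem_single hH hl hx h3 h1)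
      have h4 : c ∉ H'.hand (Γ.single l) := fun h3 => hcx (eq_of_mem_single hH' hl hx h3 h2)
      rw [H.eq_of_mem hc ((mem_main_iff hH hl).2 h3)]
      exact (mem_main_iff hH' hl).2 h4
  ext P c
  refine ⟨key P c, fun hc => ?_⟩
  obtain ⟨Q, hQ⟩ := H.cover c
  rwa [H'.eq_of_mem hc (key Q c hQ)]

/-- Any choice of one card from each group is realized by a deal, if there is one at all. -/
theorem exists_deal [Fintype ι] {H : Deal s C} (hH : H ∈ Γ.deals s) (σ : ι → C)
    (hσ : ∀ l, σ l ∈ Γ.cards l) :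
    ∃ H' ∈ Γ.deals s, ∀ l, σ l ∈ H'.hand (Γ.single l) := by
  classical
  let part : Fin m → ι → Finset C := fun P l =>
    if P = Γ.single l then {σ l} else if P = Γ.main l then (Γ.cards l).erase (σ l) else ∅
  have hsub : ∀ P l, part P l ⊆ Γ.cards l := fun P l => by
    simp only [part]
    split_ifs
    · simpa using hσ l
    · exact Finset.erase_subset _ _
    · exact Finset.empty_subset _
  -- Moving the odd card within a group preserves how many of its cards each player holds, so hand
  -- sizes are preserved.
  have hcard : ∀ P l, (part P l).card = (H.hand P ∩ Γ.cards l).card := fun P l => by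
    obtain ⟨x, hx, hxs, h⟩ := hH l
    have hP : H.hand P ∩ Γ.cards l = if P = Γ.single l then {x} else
        if P = Γ.main l then (Γ.cards l).erase x else ∅ := by
      ext c
      split_ifs with h1 h2
      · subst h1
        simp only [Finset.mem_inter, Finset.mem_singleton]
        exact ⟨fun hc => eq_of_mem_single hH hc.2 hx hc.1 hxs, by rintro rfl; exact ⟨hxs, hx⟩⟩
      · subst h2
        simp only [Finset.mem_inter, Finset.mem_erase]
        refine ⟨fun hc => ⟨?_, hc.2⟩, fun hc => ⟨h c hc.2 hc.1, hc.2⟩⟩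
        rintro rfl
        exact h1 (H.eq_of_mem hc.1 hxs)
      · simp only [Finset.mem_inter, Finset.notMem_empty, iff_false, not_and]
        intro hc hl
        by_cases hcx : c = x
        · subst hcx
          exact h1 (H.eq_of_mem hc hxs)
        · exact h2 (H.eq_of_mem hc (h c hl hcx))
    rw [hP]
    simp only [part]
    split_ifs
    · simp
    · rw [Finset.card_erase_of_mem hx, Finset.card_erase_of_mem (hσ l)]
    · rfl
  have hdisj : ∀ T : Fin m → ι → Finset C, (∀ P l, T P l ⊆ Γ.cards l) → ∀ P,
      (Finset.univ.biUnion (T P)).card = ∑ l, (T P l).card := fun T hT P => by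
    refine Finset.card_biUnion fun l _ l' _ hne => Finset.disjoint_left.2 fun c hc hc' => ?_
    exact hne (Γ.unique l l' c (hT P l hc) (hT P l' hc'))
  refine ⟨⟨fun P => Finset.univ.biUnion (part P), ?_, ?_, ?_⟩, ?_, ?_⟩
  · intro P Q hne
    refine Finset.disjoint_left.2 fun c hc hc' => ?_
    simp only [Finset.mem_biUnion, Finset.mem_univ, true_and] at hc hc'
    obtain ⟨l, hl⟩ := hc
    obtain ⟨l', hl'⟩ := hc'
    obtain rfl := Γ.unique l l' c (hsub _ _ hl) (hsub _ _ hl')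
    simp only [part] at hl hl'
    split_ifs at hl hl' <;> simp_all
  · intro c
    obtain ⟨l, hl⟩ := Γ.cover c
    simp only [Finset.mem_biUnion, Finset.mem_univ, true_and]
    by_cases hc : c = σ l
    · exact ⟨Γ.single l, l, by simp [part, hc]⟩
    · exact ⟨Γ.main l, l, by simp [part, hc, hl, Γ.main_ne l]⟩
  · intro P
    rw [hdisj part hsub, ← H.card_hand P, Finset.sum_congr rfl fun l _ => hcard P l,
      ← hdisj (fun P l => H.hand P ∩ Γ.cards l) fun P l => Finset.inter_subset_right]
    congr 1
    ext c
    simp only [Finset.mem_biUnion, Finset.mem_univ, true_and, Finset.mem_inter]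
    exact ⟨fun ⟨_, h, _⟩ => h, fun h => (Γ.cover c).imp fun l hl => ⟨h, hl⟩⟩
  · intro l
    refine ⟨σ l, hσ l, ?_, fun y hy hne => ?_⟩ <;>
      simp only [Finset.mem_biUnion, Finset.mem_univ, true_and]
    · exact ⟨l, by simp [part]⟩
    · exact ⟨l, by simp [part, hne, hy, Γ.main_ne l]⟩
  · intro l
    simp only [Finset.mem_biUnion, Finset.mem_univ, true_and]
    exact ⟨l, by simp [part]⟩

end Grouping

/-! ### Synchronising the groups into `k` deals. -/

namespace Grouping
variable {k : ℕ} {ι : Type} (Γ : Grouping m C k ι)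

/-- `f l` runs through the cards of the group `l`, and takes its value at `a l` only once. -/
def IsSchedule (a : ι → Fin k) (f : ι → Fin k → C) : Prop :=
  ∀ l, (∀ t, f l t ∈ Γ.cards l) ∧ (∀ x ∈ Γ.cards l, ∃ t, f l t = x) ∧
    ∀ t, t ≠ a l → f l t ≠ f l (a l)

/-- The deals that agree with one column of `f` on all groups that involve a player of rank
below `i`. -/
def syncedDeals (s : Fin m → ℕ) (rank : Fin m → ℕ) (i : ℕ) (f : ι → Fin k → C) :
    Set (Deal s C) :=
  {H | H ∈ Γ.deals s ∧ ∃ t, ∀ l, min (rank (Γ.main l)) (rank (Γ.single l)) < i →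
    f l t ∈ H.hand (Γ.single l)}

variable {Γ} {a : ι → Fin k} {f : ι → Fin k → C} {rank : Fin m → ℕ} {T : Fin m}

theorem IsSchedule.ne (hf : Γ.IsSchedule a f) {l : ι} {t t' : Fin k} (h : t ≠ t')
    (hl : a l = t) : f l t ≠ f l t' := by
  subst hl
  exact ((hf l).2.2 t' h.symm).symm

/-- With all groups synced, one deal per column remains. A group labelled `t` shows its odd card of
column `t` in no other column, so hands differ between columns. Every card moves because each row
runs through a group of at least two cards. -/
theorem isDiffusion_syncedDeals [Fintype ι] (hΓ : (Γ.deals s).Nonempty) (hm : 1 < m)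
    (hf : Γ.IsSchedule a f) (hT : ∀ P, P ≠ T → rank T < rank P)
    (ha : ∀ P, P ≠ T → ∀ t, ∃ l, Γ.single l = P ∧ rank (Γ.main l) < rank P ∧ a l = t)
    {i : ℕ} (hi : ∀ P, rank P < i) : IsDiffusion k (Γ.syncedDeals s rank i f) := by
  obtain ⟨H₀, hH₀⟩ := hΓ
  have hex := fun t => exists_deal hH₀ (fun l => f l t) (fun l => (hf l).1 t)
  choose D hD hDf using hex
  have himg : Γ.syncedDeals s rank i f = Set.range D := by
    ext H
    constructor
    · rintro ⟨hH, t, ht⟩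
      refine ⟨t, deal_ext (hD t) hH fun l => ⟨f l t, (hf l).1 t, hDf t l, ht l ?_⟩⟩
      exact (min_le_left _ _).trans_lt (hi _)
    · rintro ⟨t, rfl⟩
      exact ⟨hD t, t, fun l _ => hDf t l⟩
  have hand_ne : ∀ t t', t ≠ t' → ∀ P, (D t).hand P ≠ (D t').hand P := by
    intro t t' hne P he
    -- The lowest player need not hold any odd card. She is `main` in the groups that link the
    -- player `R` of next lowest rank, and misses there exactly the odd card.
    by_cases hP : P = T
    · subst hP
      have : ((Finset.univ : Finset (Fin m)).erase P).Nonempty := by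
        rw [← Finset.card_pos, Finset.card_erase_of_mem (Finset.mem_univ _)]
        simp; omega
      obtain ⟨R, hR, hmin⟩ := Finset.exists_min_image _ rank this
      obtain ⟨l, hl, hr, hal⟩ := ha R (Finset.ne_of_mem_erase hR) t
      have hl' : Γ.main l = P := by
        by_contra h
        have := hmin (Γ.main l) (Finset.mem_erase.2 ⟨h, Finset.mem_univ _⟩)
        omega
      have h1 : f l t ∉ (D t).hand P := by
        rw [← hl', mem_main_iff (hD t) ((hf l).1 t), not_not]
        exact hDf t l
      apply h1
      rw [he, ← hl', mem_main_iff (hD t') ((hf l).1 t)]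
      intro h
      exact hf.ne hne hal (eq_of_mem_single (hD t') ((hf l).1 t) ((hf l).1 t') h (hDf t' l))
    · obtain ⟨l, hl, hr, hal⟩ := ha P hP t
      have h1 := hDf t l
      rw [hl, he, ← hl] at h1
      exact hf.ne hne hal (eq_of_mem_single (hD t') ((hf l).1 t) ((hf l).1 t') h1 (hDf t' l))
  have hinj : Function.Injective D := fun t t' h => by
    by_contra hne
    exact hand_ne t t' hne T (by rw [h])
  rw [himg]
  refine ⟨?_, ?_, ?_⟩
  · rintro _ ⟨t, rfl⟩ _ ⟨t', rfl⟩ hne P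
    exact hand_ne t t' (fun h => hne (h ▸ rfl)) P
  · intro c
    obtain ⟨l, hl⟩ := Γ.cover c
    obtain ⟨t, ht⟩ := (hf l).2.1 c hl
    obtain ⟨x, hx, hxc⟩ := Finset.exists_mem_ne (Γ.two_le l) c
    obtain ⟨t', ht'⟩ := (hf l).2.1 x hx
    refine ⟨D t, ⟨t, rfl⟩, D t', ⟨t', rfl⟩, Γ.single l, ht ▸ hDf t l, fun h => hxc ?_⟩
    exact eq_of_mem_single (hD t') hx hl (ht' ▸ hDf t' l) h
  · rw [← Set.image_univ, hinj.encard_image, Set.encard_univ]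
    simp

/-- The hand of `P` fits a column `t'` of `g`, while the groups of lower rank fit a column `t`. A
group labelled `t` in which `P` has the odd card against a lower player forces `t = t'`. For `P = T`
no group is synced yet. -/
theorem syncedDeals_succ_eq (hrank : Function.Injective rank)
    (hT : ∀ P, P ≠ T → rank T < rank P)
    (ha : ∀ P, P ≠ T → ∀ t, ∃ l, Γ.single l = P ∧ rank (Γ.main l) < rank P ∧ a l = t)
    (P : Fin m) {g : ι → Fin k → C} (hg : Γ.IsSchedule a g)
    (hfg : ∀ l, min (rank (Γ.main l)) (rank (Γ.single l)) < rank P → g l = f l) :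
    Γ.syncedDeals s rank (rank P + 1) g = Γ.syncedDeals s rank (rank P) f ∩
      {H | H.hand P ∈ {h : Finset C | ∃ t, ∀ l, (Γ.single l = P → g l t ∈ h) ∧
        (Γ.main l = P → g l t ∉ h)}} := by
  ext H
  constructor
  · rintro ⟨hH, t, ht⟩
    refine ⟨⟨hH, t, fun l hl => hfg l hl ▸ ht l (by omega)⟩, t, fun l => ⟨?_, ?_⟩⟩
    · rintro rfl
      exact ht l (Nat.lt_succ_of_le (min_le_right _ _))
    · rintro rfl h
      exact (mem_main_iff hH ((hg l).1 t)).1 h (ht l (Nat.lt_succ_of_le (min_le_left _ _)))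
  · rintro ⟨⟨hH, t, ht⟩, t', ht'⟩
    have hown : ∀ l, Γ.single l = P ∨ Γ.main l = P → g l t' ∈ H.hand (Γ.single l) := by
      rintro l (h | h)
      · rw [h]; exact (ht' l).1 h
      · have := (ht' l).2 h
        rw [← h, mem_main_iff hH ((hg l).1 t'), not_not] at this
        exact this
    have hsplit : ∀ l, min (rank (Γ.main l)) (rank (Γ.single l)) < rank P + 1 →
        min (rank (Γ.main l)) (rank (Γ.single l)) < rank P ∨ Γ.single l = P ∨ Γ.main l = P := by
      intro l hl
      rcases Nat.lt_succ_iff_lt_or_eq.1 hl with h | h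
      · exact .inl h
      · right
        rcases min_choice (rank (Γ.main l)) (rank (Γ.single l)) with h' | h'
        · exact .inr (hrank (h' ▸ h))
        · exact .inl (hrank (h' ▸ h))
    refine ⟨hH, t', fun l hl => ?_⟩
    rcases hsplit l hl with h | h
    · by_cases hP : P = T
      · subst hP
        exfalso
        have : ∀ Q, rank P ≤ rank Q := fun Q => by
          by_cases hQ : Q = P
          · rw [hQ]
          · exact (hT Q hQ).le
        have h1 := this (Γ.main l)
        have h2 := this (Γ.single l)
        omega
      · obtain ⟨l', hl', hr, hal⟩ := ha P hP t
        have hlt : min (rank (Γ.main l')) (rank (Γ.single l')) < rank P :=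
          (min_le_left _ _).trans_lt hr
        have h1 := ht l' hlt
        rw [← hfg l' hlt] at h1
        have h2 := eq_of_mem_single hH ((hg l').1 t) ((hg l').1 t') h1 (hown l' (.inl hl'))
        obtain rfl : t = t' := by
          by_contra hne
          exact hg.ne hne hal h2
        rw [hfg l h]
        exact ht l h
    · exact hown l h

/-- If the players have been grouped so that each of them but one shares `k` groups, as the one
with the single card, with players of lower rank, then they can reach a `k`-diffusion. -/
theorem reducible_deals [Fintype ι] (hm : 1 < m) (hk : 0 < k) (hrank : Function.Injective rank)
    (hT : ∀ P, P ≠ T → rank T < rank P)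
    (hkey : ∀ P, P ≠ T →
      k ≤ {l | Γ.single l = P ∧ rank (Γ.main l) < rank P}.ncard) :
    Reducible k (Γ.deals s) := by
  classical
  by_cases hΓ : (Γ.deals s).Nonempty
  swap
  · refine .of_forall_exists T fun H hH => absurd ⟨H, hH⟩ hΓ
  obtain ⟨a, ha⟩ : ∃ a : ι → Fin k, ∀ P, P ≠ T → ∀ t,
      ∃ l, Γ.single l = P ∧ rank (Γ.main l) < rank P ∧ a l = t := by
    obtain ⟨a, ha⟩ := exists_labelling hk Γ.single
      (fun P => {l | Γ.single l = P ∧ rank (Γ.main l) < rank P}) (fun P l hl => by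
        simp only [Finset.mem_filter] at hl; exact hl.2.1)
    refine ⟨a, fun P hP t => ?_⟩
    obtain ⟨l, hl, h⟩ := ha P (by
      have := hkey P hP
      rwa [Set.ncard_eq_toFinset_card', Set.toFinset_ofPred] at this) t
    simp only [Finset.mem_filter, Finset.mem_univ, true_and] at hl
    exact ⟨l, hl.1, hl.2, h⟩
  -- `d` bounds the number of rank levels left; ranks need not be consecutive, so empty levels are
  -- passed over.
  have main : ∀ d i, (∀ P, rank P < i + d) → ∀ f, Γ.IsSchedule a f →
      Reducible k (Γ.syncedDeals s rank i f) := by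
    intro d
    induction d with
    | zero => exact fun i hi f hf => .diffusion _ (isDiffusion_syncedDeals hΓ hm hf hT ha hi)
    | succ d ih =>
      intro i hi f hf
      have hi' : ∀ P, rank P < i + 1 + d := fun P => by have := hi P; omega
      by_cases hP : ∃ P, rank P = i
      · obtain ⟨P, rfl⟩ := hP
        refine .of_forall_exists P fun H hH => ?_
        obtain ⟨hH, t, ht⟩ := hH
        have : ∀ l, ∃ e : Fin k → C, (∀ t, e t ∈ Γ.cards l) ∧ (∀ x ∈ Γ.cards l, ∃ t, e t = x) ∧
            e t ∈ H.hand (Γ.single l) ∧ ∀ t, t ≠ a l → e t ≠ e (a l) := fun l => by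
          obtain ⟨x, hx, hxs, -⟩ := hH l
          obtain ⟨e, h1, h2, h3, h4⟩ :=
            exists_onto_isolating (Γ.cards l) (Γ.two_le l) (Γ.le_k l) (a l) t hx
          exact ⟨e, h1, h2, h3 ▸ hxs, h4⟩
        choose e he using this
        -- Rows already synced are kept; new rows place the actual odd card in the true column `t`.
        let g : ι → Fin k → C := fun l =>
          if min (rank (Γ.main l)) (rank (Γ.single l)) < rank P then f l else e l
        have hg : Γ.IsSchedule a g := fun l => by
          simp only [g]
          split_ifs
          · exact hf l
          · exact ⟨(he l).1, (he l).2.1, (he l).2.2.2⟩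
        have hgt : ∀ l, g l t ∈ H.hand (Γ.single l) := fun l => by
          simp only [g]
          split_ifs with h
          · exact ht l h
          · exact (he l).2.2.1
        refine ⟨{h | ∃ t, ∀ l, (Γ.single l = P → g l t ∈ h) ∧ (Γ.main l = P → g l t ∉ h)},
          ⟨t, fun l => ⟨?_, ?_⟩⟩, ?_⟩
        · rintro rfl; exact hgt l
        · rintro rfl h
          exact (mem_main_iff hH ((hg l).1 t)).1 h (hgt l)
        · rw [← syncedDeals_succ_eq hrank hT ha P hg fun l hl => if_pos hl]
          exact ih _ hi' g hg
      · have : Γ.syncedDeals s rank i f = Γ.syncedDeals s rank (i + 1) f := by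
          have hiff : ∀ l, min (rank (Γ.main l)) (rank (Γ.single l)) < i ↔
              min (rank (Γ.main l)) (rank (Γ.single l)) < i + 1 := fun l => by
            have h1 : rank (Γ.main l) ≠ i := fun h => hP ⟨_, h⟩
            have h2 : rank (Γ.single l) ≠ i := fun h => hP ⟨_, h⟩
            omega
          simp only [syncedDeals, hiff]
        rw [this]
        exact ih _ hi' f hf
  have hf : ∀ l, ∃ e : Fin k → C, (∀ t, e t ∈ Γ.cards l) ∧ (∀ x ∈ Γ.cards l, ∃ t, e t = x) ∧
      ∀ t, t ≠ a l → e t ≠ e (a l) := fun l => by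
    obtain ⟨x, hx⟩ : (Γ.cards l).Nonempty := Finset.card_pos.1 (by have := Γ.two_le l; omega)
    obtain ⟨e, h1, h2, -, h4⟩ :=
      exists_onto_isolating (Γ.cards l) (Γ.two_le l) (Γ.le_k l) (a l) ⟨0, hk⟩ hx
    exact ⟨e, h1, h2, h4⟩
  choose f hf using hf
  have := main (∑ P, rank P + 1) 0 (fun P => by
    have := Finset.single_le_sum (f := rank) (fun _ _ => Nat.zero_le _) (Finset.mem_univ P)
    omega) f hf
  have he : Γ.syncedDeals s rank 0 f = Γ.deals s := by
    ext H
    exact ⟨fun h => h.1, fun h => ⟨h, ⟨0, hk⟩, fun l hl => absurd hl (Nat.not_lt_zero _)⟩⟩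
  rwa [he] at this

end Grouping

/-! ### The grouping game and its realization by announcements. -/

/-- The pairs `(B, Q)` in `L` link the players: with respect to some ranking with least element
`T`, every other player `P` occurs `k` times after players of lower rank. -/
def IsLinked (k : ℕ) (L : List (Fin m × Fin m)) : Prop :=
  ∃ (T : Fin m) (rank : Fin m → ℕ), Function.Injective rank ∧ (∀ P, P ≠ T → rank T < rank P) ∧
    ∀ P, P ≠ T → k ≤ L.countP (fun e => e.2 = P ∧ rank e.1 < rank P)

/-- The numbers of cards that remain after `B` has put `j` cards and `Q` one card in a group. -/
def afterMove (r : Fin m → ℕ) (B : Fin m) (j : ℕ) (Q : Fin m) : Fin m → ℕ :=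
  fun P => if P = B then r P - j else if P = Q then r P - 1 else r P

/-- The positions `r` of the following game, with history `L`, from which one can win: one chooses
a player `B` who puts between `1` and `k - 1` cards in a group, an adversary chooses a player `Q`
who puts one card in it. The game is won if all cards are used and the history is linked. -/
inductive Winning (k : ℕ) : (Fin m → ℕ) → List (Fin m × Fin m) → Prop
  | done (r L) : (∀ P, r P = 0) → IsLinked k L → Winning k r L
  | move (r L) (B : Fin m) (j : ℕ) : 1 ≤ j → j < k → j ≤ r B → (∃ Q, Q ≠ B ∧ 0 < r Q) →
      (∀ Q, Q ≠ B → 0 < r Q → Winning k (afterMove r B j Q) ((B, Q) :: L)) → Winning k r L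

/-- A set of cards, all but one of which are to be held by `main`, and one by `single`. -/
structure Group (m : ℕ) (C : Type) where
  cards : Finset C
  main : Fin m
  single : Fin m

/-- The hand of `single` and the hand of `main` meet the group as they should. -/
def Group.IsHeld (g : Group m C) (H : Deal s C) : Prop :=
  ∃ x ∈ g.cards, x ∈ H.hand g.single ∧ ∀ y ∈ g.cards, y ≠ x → y ∈ H.hand g.main

/-- The groups in the list are disjoint and have between `2` and `k` cards. -/
structure IsGroupList (k : ℕ) (Γ : List (Group m C)) : Prop where
  main_ne : ∀ g ∈ Γ, g.main ≠ g.single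
  two_le : ∀ g ∈ Γ, 2 ≤ g.cards.card
  le_k : ∀ g ∈ Γ, g.cards.card ≤ k
  disjoint : Γ.Pairwise fun g g' => Disjoint g.cards g'.cards

/-- The cards of `P` outside the groups. -/
def freeHand [DecidableEq C] (Γ : List (Group m C)) (H : Deal s C) (P : Fin m) : Finset C :=
  (H.hand P).filter fun c => ∀ g ∈ Γ, c ∉ g.cards

theorem countP_eq_ncard {α : Type*} (L : List α) (p : α → Prop) [DecidablePred p] :
    L.countP (fun e => p e) = {i : Fin L.length | p (L.get i)}.ncard := by
  have h : (Finset.univ.val.map L.get : Multiset α) = (L : Multiset α) := by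
    rw [Fin.univ_val_map, List.ofFn_get]
  have h2 : Multiset.countP p (L : Multiset α) = L.countP (fun e => p e) := rfl
  rw [← h2, ← h, Multiset.countP_map, Set.ncard_eq_toFinset_card', Set.toFinset_ofPred]
  rfl

theorem reducible_of_isLinked {k : ℕ} (hm : 1 < m) (hk : 0 < k) [DecidableEq C]
    {Γ : List (Group m C)} (hΓ : IsGroupList k Γ)
    (hL : IsLinked k (Γ.map fun g => (g.main, g.single)))
    (hfree : ∀ H : Deal s C, (∀ g ∈ Γ, g.IsHeld H) → ∀ P, freeHand Γ H P = ∅) :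
    Reducible k {H : Deal s C | ∀ g ∈ Γ, g.IsHeld H} := by
  obtain ⟨T, rank, hrank, hT, hkey⟩ := hL
  -- A trivial announcement provides a deal `H₀`, from which it follows that the groups cover the
  -- deck.
  refine .of_forall_exists T fun H₀ hH₀ => ⟨Set.univ, trivial, ?_⟩
  let Δ : Grouping m C k (Fin Γ.length) :=
    { cards := fun l => (Γ.get l).cards
      main := fun l => (Γ.get l).main
      single := fun l => (Γ.get l).single
      main_ne := fun l => hΓ.main_ne _ (List.get_mem _ _)
      two_le := fun l => hΓ.two_le _ (List.get_mem _ _)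
      le_k := fun l => hΓ.le_k _ (List.get_mem _ _)
      unique := fun l l' c hc hc' => by
        have hd := List.pairwise_iff_get.1 hΓ.disjoint
        by_contra hne
        rcases lt_or_gt_of_ne hne with h | h
        · exact Finset.disjoint_left.1 (hd l l' h) hc hc'
        · exact Finset.disjoint_left.1 (hd l' l h) hc' hc
      cover := fun c => by
        obtain ⟨P, hP⟩ := H₀.cover c
        have h := hfree H₀ hH₀ P
        by_contra hne
        push Not at hne
        have : c ∈ freeHand Γ H₀ P := Finset.mem_filter.2 ⟨hP, fun g hg => by
          obtain ⟨l, rfl⟩ := List.get_of_mem hg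
          exact hne l⟩
        rw [h] at this
        simp at this }
  have he : Δ.deals s = {H : Deal s C | ∀ g ∈ Γ, g.IsHeld H} ∩ {H' | H'.hand T ∈ Set.univ} := by
    ext H
    simp only [Grouping.deals, Set.mem_univ, Set.mem_inter_iff, Set.mem_ofPred_eq, and_true]
    constructor
    · intro h g hg
      obtain ⟨l, rfl⟩ := List.get_of_mem hg
      exact h l
    · exact fun h l => h _ (List.get_mem _ _)
  rw [← he]
  refine Grouping.reducible_deals hm hk hrank hT fun P hP => ?_
  have := hkey P hP
  rw [List.countP_map] at this
  exact this.trans (countP_eq_ncard Γ fun g => g.single = P ∧ rank g.main < rank P).le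

/-- All players announce the number of their cards in `G`. -/
theorem Reducible.of_counts [DecidableEq C] {k : ℕ} (G : Finset C) (l : List (Fin m)) :
    ∀ Ω : Set (Deal s C), (∀ H ∈ Ω, Reducible k
      (Ω ∩ {H' | ∀ P ∈ l, (H'.hand P ∩ G).card = (H.hand P ∩ G).card})) → Fin m →
      Reducible k Ω := by
  induction l with
  | nil =>
    refine fun Ω h P => .of_forall_exists P fun H hH => ⟨Set.univ, trivial, ?_⟩
    simpa using h H hH
  | cons P l ih =>
    refine fun Ω h _ => .of_forall_exists P fun H hH =>
      ⟨{x | (x ∩ G).card = (H.hand P ∩ G).card}, rfl, ih _ (fun H₁ hH₁ => ?_) P⟩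
    have := h H₁ hH₁.1
    convert this using 1
    ext H'
    have h1 : (H₁.hand P ∩ G).card = (H.hand P ∩ G).card := hH₁.2
    simp only [Set.mem_inter_iff, Set.mem_ofPred_eq, List.mem_cons, forall_eq_or_imp, h1, and_assoc]

/-- A group is held as it should be if and only if the numbers of cards are right. -/
theorem Group.isHeld_iff [DecidableEq C] (g : Group m C) (hne : g.main ≠ g.single)
    (H : Deal s C) : g.IsHeld H ↔ ∀ P, (H.hand P ∩ g.cards).card =
      if P = g.main then g.cards.card - 1 else if P = g.single then 1 else 0 := by
  constructor
  · rintro ⟨x, hx, hxs, h⟩ P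
    split_ifs with h1 h2
    · subst h1
      rw [← Finset.card_erase_of_mem hx]
      congr 1
      ext c
      simp only [Finset.mem_inter, Finset.mem_erase]
      refine ⟨fun hc => ⟨?_, hc.2⟩, fun hc => ⟨h c hc.2 hc.1, hc.2⟩⟩
      rintro rfl
      exact hne (H.eq_of_mem hc.1 hxs)
    · subst h2
      refine Finset.card_eq_one.2 ⟨x, ?_⟩
      ext c
      simp only [Finset.mem_inter, Finset.mem_singleton]
      refine ⟨fun hc => ?_, by rintro rfl; exact ⟨hxs, hx⟩⟩
      by_contra hcx
      exact hne (H.eq_of_mem (h c hc.2 hcx) hc.1)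
    · rw [Finset.card_eq_zero, Finset.eq_empty_iff_forall_notMem]
      intro c hc
      rw [Finset.mem_inter] at hc
      by_cases hcx : c = x
      · subst hcx
        exact h2 (H.eq_of_mem hc.1 hxs)
      · exact h1 (H.eq_of_mem hc.1 (h c hc.2 hcx))
  · intro h
    have h1 := h g.single
    rw [if_neg hne.symm, if_pos rfl] at h1
    obtain ⟨x, hx⟩ := Finset.card_eq_one.1 h1
    have hx' : x ∈ H.hand g.single ∩ g.cards := by rw [hx]; simp
    rw [Finset.mem_inter] at hx'
    refine ⟨x, hx'.2, hx'.1, fun y hy hyx => ?_⟩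
    obtain ⟨P, hP⟩ := H.cover y
    have hyP : y ∈ H.hand P ∩ g.cards := Finset.mem_inter.2 ⟨hP, hy⟩
    by_cases hPm : P = g.main
    · rwa [← hPm]
    · exfalso
      have h2 := h P
      rw [if_neg hPm] at h2
      split_ifs at h2 with hPs
      · rw [hPs, hx] at hyP
        exact hyx (by simpa using hyP)
      · rw [Finset.card_eq_zero] at h2
        rw [h2] at hyP
        simp at hyP

/-- `B` names a set with `j` of her free cards and one foreign free card, and everybody announces
how many of its cards she holds. By `Group.isHeld_iff` these counts say precisely that a new group
is held as it should be. -/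
theorem Winning.reducible [DecidableEq C] {k : ℕ} (hm : 1 < m) (hk : 0 < k) {r : Fin m → ℕ}
    {L : List (Fin m × Fin m)} (h : Winning k r L) :
    ∀ Γ : List (Group m C), IsGroupList k Γ → (Γ.map fun g => (g.main, g.single)) = L →
      (∀ H : Deal s C, (∀ g ∈ Γ, g.IsHeld H) → ∀ P, (freeHand Γ H P).card = r P) →
      Reducible k {H : Deal s C | ∀ g ∈ Γ, g.IsHeld H} := by
  induction h with
  | done r L hr hL =>
    rintro Γ hΓ rfl hfree
    exact reducible_of_isLinked hm hk hΓ hL fun H hH P =>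
      Finset.card_eq_zero.1 ((hfree H hH P).trans (hr P))
  | move r L B j h1 hjk hj hQ _ ih =>
    rintro Γ hΓ rfl hfree
    refine .of_forall_exists B fun H hH => ?_
    obtain ⟨Q, hQB, hrQ⟩ := hQ
    obtain ⟨J, hJ, hJc⟩ := Finset.exists_subset_card_eq (hj.trans (hfree H hH B).ge)
    obtain ⟨x, hx⟩ := Finset.card_pos.1 (hrQ.trans_le (hfree H hH Q).ge)
    have hxQ : x ∈ H.hand Q := (Finset.mem_filter.1 hx).1
    have hJB : J ⊆ H.hand B := fun c hc => (Finset.mem_filter.1 (hJ hc)).1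
    have hxB : x ∉ H.hand B := fun h => hQB (H.eq_of_mem hxQ h)
    have hxJ : x ∉ J := fun h => hxB (hJB h)
    have hcard : (insert x J).card = j + 1 := by rw [Finset.card_insert_of_notMem hxJ, hJc]
    refine ⟨{y | (y ∩ insert x J).card = (H.hand B ∩ insert x J).card}, rfl,
      .of_counts (insert x J) (List.finRange m) _ (fun H₁ hH₁ => ?_) B⟩
    obtain ⟨hH₁, hB⟩ := hH₁
    have hJ' : H.hand B ∩ insert x J = J := by
      rw [Finset.inter_insert_of_notMem hxB, Finset.inter_eq_right.2 hJB]
    have hB : (H₁.hand B ∩ insert x J).card = j := by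
      have h : (H₁.hand B ∩ insert x J).card = (H.hand B ∩ insert x J).card := hB
      rw [h, hJ', hJc]
    have hdis : ∀ g ∈ Γ, ∀ c ∈ insert x J, c ∉ g.cards := by
      intro g hg c hc
      rcases Finset.mem_insert.1 hc with rfl | hc
      · exact (Finset.mem_filter.1 hx).2 g hg
      · exact (Finset.mem_filter.1 (hJ hc)).2 g hg
    -- In another deal `H₁` compatible with the announcement the foreign card and its owner may
    -- differ; this owner `R` is the adversary's choice.
    obtain ⟨y, hy, hyB⟩ : ∃ y ∈ insert x J, y ∉ H₁.hand B := by
      by_contra hcon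
      push Not at hcon
      rw [Finset.inter_eq_right.2 hcon] at hB
      omega
    obtain ⟨R, hR⟩ := H₁.cover y
    have hRB : R ≠ B := by rintro rfl; exact hyB hR
    let g : Group m C := ⟨insert x J, B, R⟩
    have hg : g.IsHeld H₁ := by
      refine ⟨y, hy, hR, fun z hz hzy => ?_⟩
      have : H₁.hand B ∩ insert x J = (insert x J).erase y := by
        refine Finset.eq_of_subset_of_card_le (fun c hc => ?_) ?_
        · rw [Finset.mem_inter] at hc
          refine Finset.mem_erase.2 ⟨?_, hc.2⟩
          rintro rfl
          exact hyB hc.1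
        · rw [hB, Finset.card_erase_of_mem hy]; omega
      exact (Finset.mem_inter.1 (this.symm ▸ Finset.mem_erase.2 ⟨hzy, hz⟩)).1
    have hiff := g.isHeld_iff (s := s) hRB.symm
    have hgood := ih R hRB (by
      rw [← hfree H₁ hH₁ R]
      exact Finset.card_pos.2 ⟨y, Finset.mem_filter.2 ⟨hR, fun g hg => hdis g hg y hy⟩⟩)
      (g :: Γ) ⟨?_, ?_, ?_, ?_⟩ rfl ?_
    · convert hgood using 1
      ext H'
      simp only [Set.mem_inter_iff, Set.mem_ofPred_eq, List.mem_cons, forall_eq_or_imp,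
        List.mem_finRange, forall_const]
      rw [hiff H']
      have h2 := (hiff H₁).1 hg
      constructor
      · rintro ⟨⟨ha, -⟩, hb⟩
        exact ⟨fun P => (hb P).trans (h2 P), ha⟩
      · rintro ⟨hb, ha⟩
        have hc : ∀ P, (H'.hand P ∩ insert x J).card = (H₁.hand P ∩ insert x J).card :=
          fun P => (hb P).trans (h2 P).symm
        exact ⟨⟨ha, by rw [hc B, hB, hJ', hJc]⟩, hc⟩
    · rintro g' (_ | ⟨_, h⟩)
      · exact hRB.symm
      · exact hΓ.main_ne _ h
    · rintro g' (_ | ⟨_, h⟩)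
      · change 2 ≤ (insert x J).card; omega
      · exact hΓ.two_le _ h
    · rintro g' (_ | ⟨_, h⟩)
      · change (insert x J).card ≤ k; omega
      · exact hΓ.le_k _ h
    · exact List.pairwise_cons.2
        ⟨fun g' hg' => Finset.disjoint_left.2 fun c hc => hdis g' hg' c hc, hΓ.disjoint⟩
    · intro H' hH' P
      simp only [List.mem_cons, forall_eq_or_imp] at hH'
      have h2 := (hiff H').1 hH'.1 P
      have h3 := hfree H' hH'.2 P
      have h4 : freeHand (g :: Γ) H' P = freeHand Γ H' P \ (H'.hand P ∩ g.cards) := by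
        ext c
        simp only [freeHand, List.mem_cons, forall_eq_or_imp, Finset.mem_filter, Finset.mem_sdiff,
          Finset.mem_inter]
        tauto
      rw [h4, Finset.card_sdiff_of_subset, h2, h3]
      · simp only [afterMove, g, hcard]
        split_ifs <;> simp_all
      · intro c hc
        rw [Finset.mem_inter] at hc
        exact Finset.mem_filter.2 ⟨hc.1, fun g' hg' => hdis g' hg' c hc.2⟩

theorem Winning.solvable {k : ℕ} (hm : 1 < m) (hk : 0 < k) (h : Winning k s []) :
    Solvable k s := by
  refine Reducible.exists_isSolution (by omega) ?_
  have := h.reducible (s := s) (C := Fin (size s)) hm hk [] ⟨by simp, by simp, by simp, by simp⟩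
    rfl (fun H _ P => by simp [freeHand, H.card_hand])
  simpa using this

end SADI

/-! ### A winning strategy in the grouping game. -/

namespace SADI

variable {m : ℕ}

theorem sum_erase_afterMove {r : Fin m → ℕ} {B Q : Fin m} {j : ℕ} (hQ : Q ≠ B) (hr : 0 < r Q) :
    ∑ P ∈ Finset.univ.erase B, afterMove r B j Q P + 1 = ∑ P ∈ Finset.univ.erase B, r P := by
  have hm : Q ∈ Finset.univ.erase B := Finset.mem_erase.2 ⟨hQ, Finset.mem_univ _⟩
  rw [← Finset.add_sum_erase _ _ hm, ← Finset.add_sum_erase _ r hm]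
  have h1 : ∑ P ∈ (Finset.univ.erase B).erase Q, afterMove r B j Q P =
      ∑ P ∈ (Finset.univ.erase B).erase Q, r P := by
    refine Finset.sum_congr rfl fun P hP => ?_
    simp only [Finset.mem_erase] at hP
    simp [afterMove, hP.1, hP.2.1]
  have h2 : afterMove r B j Q Q = r Q - 1 := by simp [afterMove, hQ]
  omega

theorem countP_add_one_le {α : Type*} {p q : α → Bool} {e : α} {L : List α}
    (h : ∀ x, p x → q x) (he : q e) : L.countP p + 1 ≤ (e :: L).countP q := by
  rw [List.countP_cons_of_pos he]
  exact Nat.succ_le_succ (List.countP_mono_left fun x _ => h x)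

/-- A player `T` with at least half of the cards, but not too many, can form all groups. -/
theorem winning_of_majority {k : ℕ} (hk : 1 < k) {ord : Fin m → ℕ}
    (hord : Function.Injective ord) (T : Fin m) (d : ℕ) :
    ∀ (r : Fin m → ℕ) (L : List (Fin m × Fin m)), ∑ P ∈ Finset.univ.erase T, r P = d → d ≤ r T →
      r T ≤ (k - 1) * d →
      (∀ P, P ≠ T → k ≤ r P + L.countP (fun e => e.2 = P ∧ (e.1 = T ∨ ord P < ord e.1))) →
      Winning k r L := by
  induction d with
  | zero =>
    intro r L hd h1 h2 h3
    have hr : ∀ P, r P = 0 := fun P => by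
      by_cases hP : P = T
      · subst hP; omega
      · exact Finset.sum_eq_zero_iff.1 hd P (Finset.mem_erase.2 ⟨hP, Finset.mem_univ _⟩)
    have hle : ∀ P, ord P ≤ ∑ P, ord P := fun P =>
      Finset.single_le_sum (f := ord) (fun _ _ => Nat.zero_le _) (Finset.mem_univ P)
    -- The final ranking puts `T` lowest and reverses `ord` on the others.
    refine .done _ _ hr ⟨T, fun P => if P = T then 0 else ∑ P, ord P + 1 - ord P, ?_, ?_, ?_⟩
    · intro P Q h
      have hP := hle P
      have hQ := hle Q
      dsimp only at h
      split_ifs at h with h1 h2 h2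
      · rw [h1, h2]
      · omega
      · omega
      · exact hord (by omega)
    · intro P hP
      have := hle P
      simp only [if_true, if_neg hP]
      omega
    · intro P hP
      have h := h3 P hP
      rw [hr P, zero_add] at h
      refine h.trans (List.countP_mono_left fun e _ he => ?_)
      simp only [decide_eq_true_eq] at he ⊢
      refine ⟨he.1, ?_⟩
      have h1 := hle P
      have h2 := hle e.1
      rw [if_neg hP]
      split_ifs with hT
      · omega
      · have := he.2.resolve_left hT
        omega
  | succ d ih =>
    intro r L hd h1 h2 h3
    rw [Nat.mul_succ] at h2
    have hkd : d ≤ (k - 1) * d := Nat.le_mul_of_pos_left _ (by omega)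
    -- `T` spends as much as possible without falling below the number `d` of foreign cards left.
    obtain ⟨j, hj1, hjk, hjr, hlo, hhi⟩ : ∃ j, 1 ≤ j ∧ j < k ∧ j ≤ r T ∧ d ≤ r T - j ∧
        r T - j ≤ (k - 1) * d := by
      by_cases h : d + (k - 1) ≤ r T
      · exact ⟨k - 1, by omega, by omega, by omega, by omega, by omega⟩
      · exact ⟨r T - d, by omega, by omega, by omega, by omega, by omega⟩
    have hex : ∃ Q, Q ≠ T ∧ 0 < r Q := by
      by_contra hcon
      push Not at hcon
      have : ∑ P ∈ Finset.univ.erase T, r P = 0 := Finset.sum_eq_zero fun P hP => by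
        have := hcon P (Finset.ne_of_mem_erase hP); omega
      omega
    refine .move _ _ T j hj1 hjk hjr hex fun Q hQ hrQ => ?_
    have hT : afterMove r T j Q T = r T - j := by simp [afterMove]
    refine ih _ _ ?_ (by rw [hT]; exact hlo) (by rw [hT]; exact hhi) fun P hP => ?_
    · have := sum_erase_afterMove (j := j) hQ hrQ
      omega
    · have h4 := h3 P hP
      by_cases hPQ : P = Q
      · subst hPQ
        have h5 : afterMove r T j P P = r P - 1 := by simp [afterMove, hP]
        have h6 := countP_add_one_le (L := L) (e := (T, P))
          (p := fun e => e.2 = P ∧ (e.1 = T ∨ ord P < ord e.1))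
          (q := fun e => e.2 = P ∧ (e.1 = T ∨ ord P < ord e.1)) (fun _ h => h) (by simp)
        omega
      · have h5 : afterMove r T j Q P = r P := by simp [afterMove, hP, hPQ]
        have h6 := (List.sublist_cons_self (T, Q) L).countP_le
          (p := fun e => e.2 = P ∧ (e.1 = T ∨ ord P < ord e.1))
        omega

/-- What holds when only moves with `j = k - 1` have been made, each by the first player with `2k`
cards left, from the position `s`; `u P` is the number of moves that `P` has made. -/
structure IsReached (k : ℕ) (s ord : Fin m → ℕ) (T : Fin m) (r : Fin m → ℕ)
    (L : List (Fin m × Fin m)) (u : Fin m → ℕ) : Prop where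
  add_le : ∀ P, r P + (k - 1) * u P ≤ s P
  le_add : ∀ P, s P ≤ r P + (k - 1) * u P + ∑ E, u E
  linked : ∀ P, k ≤ r P + L.countP (fun e => e.2 = P ∧ ord P < ord e.1)
  lt_of_moved : ∀ P, 0 < u P → ∀ E, ord E < ord P → r E < 2 * k
  last : u T = 0
  bound : ∀ P, k * r P ≤ (k - 1) * ∑ E, r E

/-- Since `k - 1 ≥ 2 * m`, the moves of all players together cost each hand few single cards
compared with `b`. -/
theorem two_mul_sum_le {k : ℕ} (hk : 2 * m < k) {u : Fin m → ℕ} {b : ℕ}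
    (h : ∀ E, (k - 1) * u E ≤ b) : 2 * ∑ E, u E ≤ b := by
  rcases Nat.eq_zero_or_pos m with rfl | hm
  · simp
  have h1 : (k - 1) * ∑ E, u E ≤ m * b := by
    rw [Finset.mul_sum]
    simpa using Finset.sum_le_card_nsmul Finset.univ _ b fun E _ => h E
  have h2 : 2 * m * ∑ E, u E ≤ (k - 1) * ∑ E, u E := Nat.mul_le_mul_right _ (by omega)
  refine Nat.le_of_mul_le_mul_left (?_ : m * (2 * ∑ E, u E) ≤ m * b) hm
  calc m * (2 * ∑ E, u E) = 2 * m * ∑ E, u E := by ring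
    _ ≤ _ := h2.trans h1

variable {k : ℕ} {s ord : Fin m → ℕ} {T : Fin m}

/-- The delicate invariant is `linked`. A card that `Q` loses to a group of a later player counts as
a link. If `B` precedes `Q`, all movers so far have initial hands no larger than that of `Q`, so `Q`
has lost at most half of her initial hand, which had at least `2k` cards. -/
theorem IsReached.move {r u : Fin m → ℕ} {L : List (Fin m × Fin m)} (hk : 2 * m < k) (hk4 : 4 ≤ k)
    (hmono : ∀ P Q, ord P < ord Q → s P ≤ s Q) (hord : Function.Injective ord)
    (h : IsReached k s ord T r L u) {B Q : Fin m} (hBT : B ≠ T) (hB : 2 * k ≤ r B)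
    (hmin : ∀ E, ord E < ord B → r E < 2 * k) (hQ : Q ≠ B) (hrQ : 0 < r Q)
    (hhalf : ∀ P, 2 * r P < ∑ E, r E) (hbig : 3 * k ≤ ∑ E, r E) :
    IsReached k s ord T (afterMove r B (k - 1) Q) ((B, Q) :: L)
      (fun P => if P = B then u P + 1 else u P) := by
  have hB' : afterMove r B (k - 1) Q B = r B - (k - 1) := by simp [afterMove]
  have hQ' : afterMove r B (k - 1) Q Q = r Q - 1 := by simp [afterMove, hQ]
  have hP' : ∀ P, P ≠ B → P ≠ Q → afterMove r B (k - 1) Q P = r P := fun P h1 h2 => by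
    simp [afterMove, h1, h2]
  have hle : ∀ P, afterMove r B (k - 1) Q P ≤ r P := fun P => by
    simp only [afterMove]; split_ifs <;> omega
  have hsum : ∑ P, (if P = B then u P + 1 else u P) = ∑ P, u P + 1 := by
    rw [← Finset.add_sum_erase _ _ (Finset.mem_univ B),
      ← Finset.add_sum_erase _ u (Finset.mem_univ B), if_pos rfl,
      Finset.sum_congr rfl fun P hP => if_neg (Finset.ne_of_mem_erase hP)]
    ring
  have hrsum : ∑ P, afterMove r B (k - 1) Q P + k = ∑ P, r P := by
    have h1 := sum_erase_afterMove (j := k - 1) hQ hrQ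
    have h2 := Finset.add_sum_erase Finset.univ (afterMove r B (k - 1) Q) (Finset.mem_univ B)
    have h3 := Finset.add_sum_erase Finset.univ r (Finset.mem_univ B)
    omega
  have hadd : ∀ P, afterMove r B (k - 1) Q P + (k - 1) * (if P = B then u P + 1 else u P) ≤ s P := by
    intro P
    have h1 := h.add_le P
    have h2 := hle P
    split_ifs with hPB
    · subst hPB
      rw [Nat.mul_succ]
      omega
    · omega
  have hle_add : ∀ P, s P ≤ afterMove r B (k - 1) Q P +
      (k - 1) * (if P = B then u P + 1 else u P) +
        ∑ P, (if P = B then u P + 1 else u P) := by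
    intro P
    have h1 := h.le_add P
    rw [hsum]
    by_cases hPB : P = B
    · subst hPB
      rw [if_pos rfl, Nat.mul_succ]
      omega
    · rw [if_neg hPB]
      by_cases hPQ : P = Q
      · subst hPQ; omega
      · rw [hP' P hPB hPQ]; omega
  have hmoved : ∀ P, 0 < (if P = B then u P + 1 else u P) → ∀ E, ord E < ord P → r E < 2 * k := by
    intro P hP E hE
    split_ifs at hP with hPB
    · exact hmin E (hPB ▸ hE)
    · exact h.lt_of_moved P hP E hE
  refine ⟨hadd, hle_add, fun P => ?_, fun P hP E hE => (hle E).trans_lt (hmoved P hP E hE), ?_,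
    fun P => ?_⟩
  · by_cases hPB : P = B
    · subst hPB; omega
    have h1 := h.linked P
    by_cases hPQ : P = Q
    · subst hPQ
      rcases lt_or_gt_of_ne (hord.ne hPB) with hlt | hlt
      · have h6 := countP_add_one_le (L := L) (e := (B, P))
          (p := fun e => e.2 = P ∧ ord P < ord e.1)
          (q := fun e => e.2 = P ∧ ord P < ord e.1) (fun _ h => h) (by simpa using hlt)
        omega
      · have hu : (if P = B then u P + 1 else u P) = 0 := by
          rw [if_neg hPB]
          by_contra hne
          have := h.lt_of_moved P (Nat.pos_of_ne_zero hne) B hlt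
          omega
        have h2 : 2 * ∑ E, (if E = B then u E + 1 else u E) ≤ s P := by
          refine two_mul_sum_le hk fun E => ?_
          rcases Nat.eq_zero_or_pos (if E = B then u E + 1 else u E) with h0 | h0
          · rw [h0]; simp
          · refine (Nat.le_of_add_left_le (hadd E)).trans (hmono E P ?_)
            by_contra hcon
            have := hmoved E h0 B (by omega)
            omega
        have h3 := hle_add P
        rw [hu, Nat.mul_zero] at h3
        have h4 := hmono B P hlt
        have h5 := h.add_le B
        omega
    · have h6 := (List.sublist_cons_self (B, Q) L).countP_le
          (p := fun e => e.2 = P ∧ ord P < ord e.1)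
      rw [hP' P hPB hPQ]
      omega
  · simpa [hBT.symm] using h.last
  -- No hand reaches half of the `n + k` cards before the move, and `n ≥ 2 * k`; for `k ≥ 4` this
  -- leaves each hand at most `(k - 1) / k` of the `n` cards after it.
  · have h1 := hhalf P
    have h2 := hle P
    obtain ⟨n, hn⟩ : ∃ n, ∑ E, afterMove r B (k - 1) Q E = n := ⟨_, rfl⟩
    rw [hn] at hrsum ⊢
    rw [← hrsum] at h1 hbig
    obtain ⟨κ, rfl⟩ : ∃ κ, k = κ + 4 := ⟨k - 4, by omega⟩
    rw [show κ + 4 - 1 = κ + 3 by omega] at *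
    nlinarith

theorem winning_of_isReached (hk : 2 * m < k) (hk4 : 4 ≤ k)
    (hmono : ∀ P Q, ord P < ord Q → s P ≤ s Q) (hord : Function.Injective ord)
    (hT : ∀ P, P ≠ T → ord P < ord T) (hs : 4 * m * k < s T) (n : ℕ) :
    ∀ r L u, ∑ P, r P = n → IsReached k s ord T r L u → Winning k r L := by
  induction n using Nat.strong_induction_on with
  | _ n ih =>
    intro r L u hn h
    by_cases hhalf : ∃ P, ∑ E, r E ≤ 2 * r P
    · obtain ⟨R, hR⟩ := hhalf
      have h1 := Finset.add_sum_erase Finset.univ r (Finset.mem_univ R)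
      have h2 := h.bound R
      refine winning_of_majority (by omega) hord R _ r L rfl (by omega) ?_ fun P _ =>
        (h.linked P).trans (Nat.add_le_add_left (List.countP_mono_left fun e _ he => ?_) _)
      -- After cancellation, `bound` says that `R` has at most `k - 1` cards per foreign card.
      · rw [← h1, Nat.mul_add] at h2
        obtain ⟨κ, rfl⟩ : ∃ κ, k = κ + 1 := ⟨k - 1, by omega⟩
        rw [Nat.add_sub_cancel] at *
        rw [Nat.succ_mul] at h2
        omega
      · simp only [decide_eq_true_eq] at he ⊢
        exact ⟨he.1, .inr he.2⟩
    push Not at hhalf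
    -- `T` never moves, so she keeps half of her initial hand, more than `2mk` cards. As this is
    -- less than half of all cards, some other player has at least `2k`.
    have hrT : s T ≤ 2 * r T := by
      have h1 := h.le_add T
      rw [h.last, Nat.mul_zero] at h1
      have h2 : 2 * ∑ E, u E ≤ s T := two_mul_sum_le hk fun E => by
        refine (Nat.le_of_add_left_le (h.add_le E)).trans ?_
        by_cases hE : E = T
        · rw [hE]
        · exact hmono E T (hT E hE)
      omega
    have hmk : k ≤ m * k := Nat.le_mul_of_pos_left _ (Fin.pos T)
    have hrT' : 2 * (m * k) < r T := by nlinarith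
    have hne : (Finset.univ.filter fun P => P ≠ T ∧ 2 * k ≤ r P).Nonempty := by
      by_contra hcon
      rw [Finset.not_nonempty_iff_eq_empty, Finset.filter_eq_empty_iff] at hcon
      have h1 : ∑ P ∈ Finset.univ.erase T, r P ≤ (Finset.univ.erase T).card • (2 * k) :=
        Finset.sum_le_card_nsmul _ _ _ fun P hP => by
          have := hcon (Finset.mem_univ P)
          have hP' := Finset.ne_of_mem_erase hP
          by_contra hlt
          exact this ⟨hP', by omega⟩
      have h2 : (Finset.univ.erase T).card ≤ m :=
        (Finset.card_le_card (Finset.erase_subset _ _)).trans (by simp)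
      have h3 := Finset.add_sum_erase Finset.univ r (Finset.mem_univ T)
      have h4 := hhalf T
      have h5 : (Finset.univ.erase T).card • (2 * k) ≤ m * (2 * k) := Nat.mul_le_mul_right _ h2
      have h6 : m * (2 * k) = 2 * (m * k) := by ring
      omega
    obtain ⟨B, hB, hmin⟩ := Finset.exists_min_image _ ord hne
    simp only [Finset.mem_filter, Finset.mem_univ, true_and] at hB hmin
    refine .move _ _ B (k - 1) (by omega) (by omega) (by omega) ⟨T, hB.1.symm, by omega⟩
      fun Q hQ hrQ => ?_
    have hstep := h.move hk hk4 hmono hord hB.1 hB.2 (fun E hE => ?_) hQ hrQ hhalf (by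
      have := hhalf T; omega)
    · refine ih _ ?_ _ _ _ rfl hstep
      rw [← hn]
      refine Finset.sum_lt_sum (fun P _ => ?_) ⟨Q, Finset.mem_univ _, ?_⟩
      · simp only [afterMove]; split_ifs <;> omega
      · simp only [afterMove, if_neg hQ, if_true]; omega
    · by_contra hcon
      have hET : E ≠ T := by
        rintro rfl
        have := hT B hB.1
        omega
      have := hmin E ⟨hET, by omega⟩
      omega

theorem winning_of_size (hk : 2 * m < k) (hk4 : 4 ≤ k) (hm : 0 < m)
    (hsize : 4 * m ^ 2 * k < size s) (hlo : ∀ P, k ≤ s P)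
    (hhi : ∀ P, k * s P ≤ (k - 1) * size s) : Winning k s [] := by
  have : Nonempty (Fin m) := ⟨⟨0, hm⟩⟩
  -- Players are ordered by hand size, with ties broken by index.
  let ord : Fin m → ℕ := fun P => s P * m + P
  have hmono : ∀ P Q, ord P < ord Q → s P ≤ s Q := fun P Q h => by
    by_contra hcon
    have h1 : (s Q + 1) * m ≤ s P * m := Nat.mul_le_mul_right _ (by omega)
    rw [Nat.succ_mul] at h1
    have h2 : s P * m + P < s Q * m + Q := h
    have := Q.isLt
    omega
  have hord : Function.Injective ord := fun P Q h => by
    have h' : s P * m + P = s Q * m + Q := h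
    have := congrArg (· % m) h'
    simp only [Nat.mul_add_mod_self_right, Nat.mod_eq_of_lt P.isLt, Nat.mod_eq_of_lt Q.isLt] at this
    exact Fin.ext this
  obtain ⟨T, -, hT⟩ := Finset.exists_max_image Finset.univ ord Finset.univ_nonempty
  have hT' : ∀ P, P ≠ T → ord P < ord T := fun P hP =>
    lt_of_le_of_ne (hT P (Finset.mem_univ _)) (hord.ne hP)
  refine winning_of_isReached (T := T) (u := fun _ => 0) hk hk4 hmono hord hT' ?_ _ _ _ rfl
    ⟨by simp, by simp, by simpa using hlo, by simp, rfl, hhi⟩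
  have h1 : size s ≤ m * s T := by
    have := Finset.sum_le_card_nsmul Finset.univ s (s T) fun P _ => by
      by_cases hP : P = T
      · rw [hP]
      · exact hmono P T (hT' P hP)
    simpa [size] using this
  refine Nat.lt_of_mul_lt_mul_left (a := m) ?_
  calc m * (4 * m * k) = 4 * m ^ 2 * k := by ring
    _ < _ := hsize.trans_le h1

end SADI

theorem theorem3 (m k : ℕ) (hm : 2 < m) (hk : 2 * m < k) :
    ∃ N : ℕ, ∀ s : Fin m → ℕ, N < SADI.size s →
      (∀ P : Fin m, k ^ 2 ≤ k * s P ∧ k * s P ≤ (k - 1) * SADI.size s) →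
      SADI.Solvable k s := by
  refine ⟨4 * m ^ 2 * k, fun s hs h => ?_⟩
  refine SADI.Winning.solvable (by omega) (by omega)
    (SADI.winning_of_size hk (by omega) (by omega) hs (fun P => ?_) fun P => (h P).2)
  exact Nat.le_of_mul_le_mul_left (sq k ▸ (h P).1) (by omega)
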